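/- Let $n\in\mathbb N$, let $\Omega\subset\mathbb R^n$ be open, let $s\in(0,1)$, and let $q:\Omega\to[1,\infty)$ and $p:\Omega\times\Omega\to[1,\infty)$ be measurable with $$1<\operatorname*{ess\,inf}_{\Omega} q\le\operatorname*{ess\,sup}_{\Omega} q<\infty,\qquad 1<\operatorname*{ess\,inf}_{\Omega\times\Omega} p\le\operatorname*{ess\,sup}_{\Omega\times\Omega} p<\infty .$$ For a measurable set $A$, a variable exponent $r$ on $A$ and a measurable $f:A\to\mathbb R$ put $\rho_{r(\cdot)}(f)=\int_A|f(x)|^{r(x)}\,dx$. Then $L^{r(\cdot)}(A)$ is the space of measurable $f$ with $\rho_{r(\cdot)}(\lambda f)<\infty$ for some $\lambda>0$, with the Luxemburg norm $\|f\|_{L^{r(\cdot)}(A)}=\inf\{\lambda>0:\rho_{r(\cdot)}(f/\lambda)\le1\}$. The space $\mathcal W^{s,q(\cdot),p(\cdot,\cdot)}(\Omega)$ consists of all $u\in L^{q(\cdot)}(\Omega)$ such that $D u(x,y):=|u(x)-u(y)|\,|x-y|^{-s-n/p(x,y)}$ belongs to $L^{p(\cdot,\cdot)}(\Omega\times\Omega)$.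 It carries the norm $\|u\|_{L^{q(\cdot)}(\Omega)}+\|D u\|_{L^{p(\cdot,\cdot)}(\Omega\times\Omega)}$ and the modular $$\rho(u)=\int_\Omega|u(x)|^{q(x)}\,dx+\int_\Omega\int_\Omega\frac{|u(x)-u(y)|^{p(x,y)}}{|x-y|^{n+sp(x,y)}}\,dx\,dy .$$ Let $\widetilde{\mathcal W}^{s,q(\cdot),p(\cdot,\cdot)}(\Omega)$ be the closure in $\mathcal W^{s,q(\cdot),p(\cdot,\cdot)}(\Omega)$ of $\mathcal W^{s,q(\cdot),p(\cdot,\cdot)}(\Omega)\cap C_c(\overline\Omega)$, where $C_c(\overline\Omega)$ is the space of continuous functions on $\overline\Omega$ with compact support in $\overline\Omega$. For a relatively open $O\subset\overline\Omega$ let $C(O)=\inf\{\rho(w): w\in\widetilde{\mathcal W}^{s,q(\cdot),p(\cdot,\cdot)}(\Omega),\ w\ge1\text{ a.e. on }O\cap\Omega\}$ (with $\inf\varnothing=\infty$), and for any $E\subset\overline\Omega$ let $C(E)=\inf\{C(O):O\supset E\text{ relatively open in }\overline\Omega\}$. A real-valued function $u$ defined on $\overline\Omega$ (or on a larger set) is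 called relatively quasicontinuous if for every $\varepsilon>0$ there is a relatively open set $O\subset\overline\Omega$ with $C(O)<\varepsilon$ such that the restriction of $u$ to $\overline\Omega\setminus O$ is continuous. A property holds relatively quasi everywhere (r.q.e.) in a set $A\subset\mathbb R^n$ if it holds on $A\setminus P$ for some $P\subset A\cap\overline\Omega$ with $C(P)=0$. Let $\widetilde{\mathcal W}_0^{s,q(\cdot),p(\cdot,\cdot)}(\Omega)$ be the set of all functions $u$ on $\Omega$ for which there is a relatively quasicontinuous function $\tilde u:\mathbb R^n\to\mathbb R$ with $\tilde u|_\Omega\in\widetilde{\mathcal W}^{s,q(\cdot),p(\cdot,\cdot)}(\Omega)$, $\tilde u=u$ a.e. in $\Omega$, and $\tilde u=0$ r.q.e. in $\Omega^c$. **Proposition.** Let $u\in\widetilde{\mathcal W}_0^{s,q(\cdot),p(\cdot,\cdot)}(\Omega)$ and $v\in\widetilde{\mathcal W}^{s,q(\cdot),p(\cdot,\cdot)}(\Omega)$ be (essentially) bounded in $\Omega$, and assume that $v$ is relatively quasicontinuous. Then $uv\in\widetilde{\mathcal W}_0^{s,q(\cdot),p(\cdot,\cdot)}(\Omega)$. 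-/

import Mathlib

open MeasureTheory Set
open scoped ENNReal

noncomputable section

namespace VarSobolev

/-! ### Variable exponents and variable exponent Lebesgue spaces -/

/-- `r` is an admissible variable exponent on the set `A`: it is a (Lebesgue) measurable function
`A → [1, ∞)` with `1 < ess inf_A r` and `ess sup_A r < ∞`. Values outside `A` are irrelevant. -/
structure IsExponentOn {α : Type*} [MeasureSpace α] (A : Set α) (r : α → ℝ) : Prop where
  aemeasurable : AEMeasurable r (volume.restrict A)
  one_le : ∀ x ∈ A, 1 ≤ r x
  lower : ∃ a : ℝ, 1 < a ∧ ∀ᵐ x ∂(volume.restrict A), a ≤ r x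
  upper : ∃ b : ℝ, ∀ᵐ x ∂(volume.restrict A), r x ≤ b

/-- The modular `∫_A |f(x)|^{r(x)} dx` of the variable exponent Lebesgue space `L^{r(.)}(A)`. -/
def lebesgueModular {α : Type*} [MeasureSpace α] (A : Set α) (r f : α → ℝ) : ℝ≥0∞ :=
  ∫⁻ x in A, ENNReal.ofReal (|f x| ^ r x)

/-- Membership in the variable exponent Lebesgue space `L^{r(.)}(A)`. -/
def MemLebesgue {α : Type*} [MeasureSpace α] (A : Set α) (r f : α → ℝ) : Prop :=
  AEMeasurable f (volume.restrict A) ∧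
    ∃ l : ℝ, 0 < l ∧ lebesgueModular A r (fun x => l * f x) < ∞

/-- The Luxemburg norm of `L^{r(.)}(A)`. -/
def luxemburgNorm {α : Type*} [MeasureSpace α] (A : Set α) (r f : α → ℝ) : ℝ :=
  sInf {l : ℝ | 0 < l ∧ lebesgueModular A r (fun x => f x / l) ≤ 1}

/-! ### Fractional Sobolev spaces with variable exponents

Functions on `Ω` or on its closure are represented by functions on the whole of `ℝⁿ`; only their
values on `Ω`, respectively on the closure, matter. -/

variable {n : ℕ}

/-- The quotient `|u(x) - u(y)| / |x - y|^{s + n / p(x,y)}`. Its power of exponent `p(x,y)` is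
`|u(x) - u(y)|^{p(x,y)} / |x - y|^{n + s p(x,y)}`. -/
def gagliardoQuotient (s : ℝ) (p : EuclideanSpace ℝ (Fin n) × EuclideanSpace ℝ (Fin n) → ℝ)
    (u : EuclideanSpace ℝ (Fin n) → ℝ) :
    EuclideanSpace ℝ (Fin n) × EuclideanSpace ℝ (Fin n) → ℝ :=
  fun z => |u z.1 - u z.2| / ‖z.1 - z.2‖ ^ (s + (n : ℝ) / p z)

/-- The modular `ρ(u) = ∫_Ω |u|^{q(x)} dx + ∫_Ω ∫_Ω |u(x)-u(y)|^{p(x,y)} / |x-y|^{n+sp(x,y)} dx dy`. -/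
def sobolevModular (Ω : Set (EuclideanSpace ℝ (Fin n))) (s : ℝ)
    (q : EuclideanSpace ℝ (Fin n) → ℝ)
    (p : EuclideanSpace ℝ (Fin n) × EuclideanSpace ℝ (Fin n) → ℝ)
    (u : EuclideanSpace ℝ (Fin n) → ℝ) : ℝ≥0∞ :=
  lebesgueModular Ω q u + lebesgueModular (Ω ×ˢ Ω) p (gagliardoQuotient s p u)

/-- The norm of `W^{s,q(.),p(.,.)}(Ω)`: the Luxemburg norm in `L^{q(.)}(Ω)` plus the Gagliardo
seminorm. -/
def sobolevNorm (Ω : Set (EuclideanSpace ℝ (Fin n))) (s : ℝ)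
    (q : EuclideanSpace ℝ (Fin n) → ℝ)
    (p : EuclideanSpace ℝ (Fin n) × EuclideanSpace ℝ (Fin n) → ℝ)
    (u : EuclideanSpace ℝ (Fin n) → ℝ) : ℝ :=
  luxemburgNorm Ω q u + luxemburgNorm (Ω ×ˢ Ω) p (gagliardoQuotient s p u)

/-- The fractional Sobolev space `W^{s,q(.),p(.,.)}(Ω)`. -/
def sobolevSpace (Ω : Set (EuclideanSpace ℝ (Fin n))) (s : ℝ)
    (q : EuclideanSpace ℝ (Fin n) → ℝ)
    (p : EuclideanSpace ℝ (Fin n) × EuclideanSpace ℝ (Fin n) → ℝ) :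
    Set (EuclideanSpace ℝ (Fin n) → ℝ) :=
  {u | MemLebesgue Ω q u ∧ MemLebesgue (Ω ×ˢ Ω) p (gagliardoQuotient s p u)}

/-- `C_c(closure Ω)`: continuous functions on `closure Ω` with compact support in `closure Ω`. -/
def ccClosure (Ω : Set (EuclideanSpace ℝ (Fin n))) : Set (EuclideanSpace ℝ (Fin n) → ℝ) :=
  {φ | ContinuousOn φ (closure Ω) ∧
    ∃ K : Set (EuclideanSpace ℝ (Fin n)), IsCompact K ∧ K ⊆ closure Ω ∧
      ∀ x ∈ closure Ω \ K, φ x = 0}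

/-- `W̃^{s,q(.),p(.,.)}(Ω)`: the closure of `W^{s,q(.),p(.,.)}(Ω) ∩ C_c(closure Ω)` in
`W^{s,q(.),p(.,.)}(Ω)`. -/
def sobolevTilde (Ω : Set (EuclideanSpace ℝ (Fin n))) (s : ℝ)
    (q : EuclideanSpace ℝ (Fin n) → ℝ)
    (p : EuclideanSpace ℝ (Fin n) × EuclideanSpace ℝ (Fin n) → ℝ) :
    Set (EuclideanSpace ℝ (Fin n) → ℝ) :=
  {u | u ∈ sobolevSpace Ω s q p ∧ ∀ ε : ℝ, 0 < ε →
    ∃ φ ∈ sobolevSpace Ω s q p ∩ ccClosure Ω, sobolevNorm Ω s q p (fun x => u x - φ x) < ε}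

/-! ### Relative capacity and relative quasicontinuity -/

/-- `O ⊆ closure Ω` is open in the relative topology of `closure Ω`. -/
def IsRelOpen (Ω O : Set (EuclideanSpace ℝ (Fin n))) : Prop :=
  ∃ U : Set (EuclideanSpace ℝ (Fin n)), IsOpen U ∧ O = U ∩ closure Ω

/-- The relative capacity of a relatively open set `O`: the infimum of `ρ(w)` over all
`w ∈ W̃^{s,q(.),p(.,.)}(Ω)` with `w ≥ 1` a.e. on `O` (that is, on the part `O ∩ Ω` of `O` on which
`w` is defined). -/
def relCapacityOpen (Ω : Set (EuclideanSpace ℝ (Fin n))) (s : ℝ)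
    (q : EuclideanSpace ℝ (Fin n) → ℝ)
    (p : EuclideanSpace ℝ (Fin n) × EuclideanSpace ℝ (Fin n) → ℝ)
    (O : Set (EuclideanSpace ℝ (Fin n))) : ℝ≥0∞ :=
  ⨅ w ∈ {w | w ∈ sobolevTilde Ω s q p ∧ ∀ᵐ x ∂(volume.restrict (O ∩ Ω)), 1 ≤ w x},
    sobolevModular Ω s q p w

/-- The relative capacity of `E ⊆ closure Ω`: the infimum of the capacities of the relatively open
sets containing `E`. (It is `∞` if `E` is not contained in `closure Ω`.) -/
def relCapacity (Ω : Set (EuclideanSpace ℝ (Fin n))) (s : ℝ)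
    (q : EuclideanSpace ℝ (Fin n) → ℝ)
    (p : EuclideanSpace ℝ (Fin n) × EuclideanSpace ℝ (Fin n) → ℝ)
    (E : Set (EuclideanSpace ℝ (Fin n))) : ℝ≥0∞ :=
  ⨅ O ∈ {O | IsRelOpen Ω O ∧ E ⊆ O}, relCapacityOpen Ω s q p O

/-- `u` is relatively quasicontinuous: for every `ε > 0` there is a relatively open subset `O` of
`closure Ω` of relative capacity less than `ε` such that the restriction of `u` to
`closure Ω \ O` is continuous. -/
def IsRelQuasicontinuous (Ω : Set (EuclideanSpace ℝ (Fin n))) (s : ℝ)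
    (q : EuclideanSpace ℝ (Fin n) → ℝ)
    (p : EuclideanSpace ℝ (Fin n) × EuclideanSpace ℝ (Fin n) → ℝ)
    (u : EuclideanSpace ℝ (Fin n) → ℝ) : Prop :=
  ∀ ε : ℝ, 0 < ε → ∃ O : Set (EuclideanSpace ℝ (Fin n)), IsRelOpen Ω O ∧
    relCapacity Ω s q p O < ENNReal.ofReal ε ∧ ContinuousOn u (closure Ω \ O)

/-- The property `P` holds relatively quasi everywhere in `A`. -/
def RelQuasiEverywhere (Ω : Set (EuclideanSpace ℝ (Fin n))) (s : ℝ)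
    (q : EuclideanSpace ℝ (Fin n) → ℝ)
    (p : EuclideanSpace ℝ (Fin n) × EuclideanSpace ℝ (Fin n) → ℝ)
    (A : Set (EuclideanSpace ℝ (Fin n))) (P : EuclideanSpace ℝ (Fin n) → Prop) : Prop :=
  ∃ N ⊆ A, relCapacity Ω s q p N = 0 ∧ ∀ x ∈ A \ N, P x

/-- The zero trace space `W̃₀^{s,q(.),p(.,.)}(Ω)`: functions on `Ω` which agree a.e. in `Ω` with a
relatively quasicontinuous function of `W̃^{s,q(.),p(.,.)}(Ω)` that vanishes relatively quasi
everywhere in the complement of `Ω`. -/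
def sobolevTildeZero (Ω : Set (EuclideanSpace ℝ (Fin n))) (s : ℝ)
    (q : EuclideanSpace ℝ (Fin n) → ℝ)
    (p : EuclideanSpace ℝ (Fin n) × EuclideanSpace ℝ (Fin n) → ℝ) :
    Set (EuclideanSpace ℝ (Fin n) → ℝ) :=
  {u | ∃ u' ∈ sobolevTilde Ω s q p, IsRelQuasicontinuous Ω s q p u' ∧
    (∀ᵐ x ∂(volume.restrict Ω), u' x = u x) ∧
    RelQuasiEverywhere Ω s q p Ωᶜ (fun x => u' x = 0)}

/-- `u` is (essentially) bounded on `Ω`. -/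
def IsBoundedOn (Ω : Set (EuclideanSpace ℝ (Fin n))) (u : EuclideanSpace ℝ (Fin n) → ℝ) : Prop :=
  ∃ M : ℝ, ∀ᵐ x ∂(volume.restrict Ω), |u x| ≤ M

end VarSobolev

end

/-! If `u'` is a quasicontinuous representative of `u` vanishing r.q.e. off `Ω`, then `u' * v` is
one for `u * v`: it vanishes wherever `u'` does, and it is quasicontinuous because relative capacity
is subadditive on unions (`relCapacity_union_lt`). What remains is that the product of two bounded
elements of `sobolevTilde` stays in `sobolevTilde`.

Bounded functions agree a.e. with their truncations at a common level `M`, and the product of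
truncations is a globally Lipschitz function `F` with `F 0 0 = 0`. So everything rests on
`comp_mem_sobolevTilde`: such an `F` preserves the closure of `C_c`. If `φ k → u` and `ψ k → v`, the
approximants are `F (φ k) (ψ k)`. The Lebesgue part of the error is controlled by the Lipschitz
bound. The Gagliardo part is not, since double differences of a Lipschitz `F` are not bounded by
those of the errors; there a.e. convergence and a dominated convergence argument
(`tendsto_gagliardo_modular`) are used.

All limits are taken in the modular, which is equivalent to norm convergence because the exponents
are bounded. -/

namespace VarSobolev

/-! ### Modular versus Luxemburg norm for bounded exponents. -/

section Lebesgue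

variable {α : Type*} [MeasureSpace α] {A : Set α} {r : α → ℝ}

theorem IsExponentOn.exists_upper (hr : IsExponentOn A r) :
    ∃ b : ℝ, 1 ≤ b ∧ ∀ᵐ x ∂(volume.restrict A), 1 ≤ r x ∧ r x ≤ b := by
  obtain ⟨a, ha, hra⟩ := hr.lower
  obtain ⟨b, hb⟩ := hr.upper
  refine ⟨max b 1, le_max_right _ _, ?_⟩
  filter_upwards [hra, hb] with x h1 h2
  exact ⟨ha.le.trans h1, h2.trans (le_max_left _ _)⟩

theorem IsExponentOn.aemeasurable_modular (hr : IsExponentOn A r) {f : α → ℝ}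
    (hf : AEMeasurable f (volume.restrict A)) :
    AEMeasurable (fun x => ENNReal.ofReal (|f x| ^ r x)) (volume.restrict A) :=
  ((continuous_abs.measurable.comp_aemeasurable hf).pow hr.aemeasurable).ennreal_ofReal

/-- The sum is at most four times its largest term, and `4 * c ≥ 1` lets `(4 * c) ^ t` be replaced
by `(4 * c) ^ b`, a constant independent of the exponent `t`. -/
theorem rpow_le_of_le_mul_add {b c t x a₁ a₂ a₃ a₄ : ℝ} (ht : 1 ≤ t) (htb : t ≤ b) (hc : 1 ≤ c)
    (hx : 0 ≤ x) (h₁ : 0 ≤ a₁) (h₂ : 0 ≤ a₂) (h₃ : 0 ≤ a₃) (h₄ : 0 ≤ a₄)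
    (h : x ≤ c * (a₁ + a₂ + a₃ + a₄)) :
    x ^ t ≤ (4 * c) ^ b * (a₁ ^ t + a₂ ^ t + (a₃ ^ t + a₄ ^ t)) := by
  have ht0 : 0 ≤ t := by linarith
  have p₁ := Real.rpow_nonneg h₁ t
  have p₂ := Real.rpow_nonneg h₂ t
  have p₃ := Real.rpow_nonneg h₃ t
  have p₄ := Real.rpow_nonneg h₄ t
  have key : ∀ a : ℝ, 0 ≤ a → a₁ ≤ a → a₂ ≤ a → a₃ ≤ a → a₄ ≤ a →
      x ^ t ≤ (4 * c) ^ b * a ^ t := by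
    intro a ha g₁ g₂ g₃ g₄
    have hxa : x ≤ (4 * c) * a := by nlinarith
    calc x ^ t ≤ ((4 * c) * a) ^ t := Real.rpow_le_rpow hx hxa ht0
      _ = (4 * c) ^ t * a ^ t := Real.mul_rpow (by linarith) ha
      _ ≤ (4 * c) ^ b * a ^ t := by
        gcongr
        linarith
  have hK : 0 ≤ (4 * c) ^ b := Real.rpow_nonneg (by linarith) b
  have step : ∀ a : ℝ, a ^ t ≤ a₁ ^ t + a₂ ^ t + (a₃ ^ t + a₄ ^ t) →
      x ^ t ≤ (4 * c) ^ b * a ^ t →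
      x ^ t ≤ (4 * c) ^ b * (a₁ ^ t + a₂ ^ t + (a₃ ^ t + a₄ ^ t)) :=
    fun a g g' => g'.trans (mul_le_mul_of_nonneg_left g hK)
  rcases le_total a₁ a₂ with g₁ | g₁ <;> rcases le_total a₃ a₄ with g₂ | g₂
  · rcases le_total a₂ a₄ with g₃ | g₃
    · exact step a₄ (by linarith) (key a₄ h₄ (by linarith) g₃ g₂ le_rfl)
    · exact step a₂ (by linarith) (key a₂ h₂ g₁ le_rfl (by linarith) g₃)
  · rcases le_total a₂ a₃ with g₃ | g₃
    · exact step a₃ (by linarith) (key a₃ h₃ (by linarith) g₃ le_rfl g₂)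
    · exact step a₂ (by linarith) (key a₂ h₂ g₁ le_rfl g₃ (by linarith))
  · rcases le_total a₁ a₄ with g₃ | g₃
    · exact step a₄ (by linarith) (key a₄ h₄ g₃ (by linarith) g₂ le_rfl)
    · exact step a₁ (by linarith) (key a₁ h₁ le_rfl g₁ (by linarith) g₃)
  · rcases le_total a₁ a₃ with g₃ | g₃
    · exact step a₃ (by linarith) (key a₃ h₃ g₃ (by linarith) le_rfl g₂)
    · exact step a₁ (by linarith) (key a₁ h₁ le_rfl g₁ g₃ (by linarith))

/-- The pointwise estimate behind all modular inequalities. -/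
theorem IsExponentOn.exists_pointwise_bound (hr : IsExponentOn A r) {c : ℝ} (hc : 1 ≤ c) :
    ∃ K : ℝ, 0 < K ∧ ∀ᵐ x ∂(volume.restrict A), ∀ y a₁ a₂ a₃ a₄ : ℝ,
      |y| ≤ c * (|a₁| + |a₂| + |a₃| + |a₄|) →
      ENNReal.ofReal (|y| ^ r x) ≤ ENNReal.ofReal K *
        ((ENNReal.ofReal (|a₁| ^ r x) + ENNReal.ofReal (|a₂| ^ r x)) +
          (ENNReal.ofReal (|a₃| ^ r x) + ENNReal.ofReal (|a₄| ^ r x))) := by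
  obtain ⟨b, -, hrb⟩ := hr.exists_upper
  have hK : 0 < (4 * c) ^ b := Real.rpow_pos_of_pos (by linarith) b
  refine ⟨(4 * c) ^ b, hK, ?_⟩
  filter_upwards [hrb] with x hx y a₁ a₂ a₃ a₄ h
  rw [← ENNReal.ofReal_add (by positivity) (by positivity),
    ← ENNReal.ofReal_add (by positivity) (by positivity),
    ← ENNReal.ofReal_add (by positivity) (by positivity), ← ENNReal.ofReal_mul hK.le]
  exact ENNReal.ofReal_le_ofReal (rpow_le_of_le_mul_add hx.1 hx.2 hc (abs_nonneg _)
    (abs_nonneg _) (abs_nonneg _) (abs_nonneg _) (abs_nonneg _) h)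

theorem IsExponentOn.exists_modular_bound (hr : IsExponentOn A r) {c : ℝ} (hc : 1 ≤ c) :
    ∃ K : ℝ, 0 < K ∧ ∀ f g h : α → ℝ, AEMeasurable g (volume.restrict A) →
      (∀ᵐ x ∂(volume.restrict A), |f x| ≤ c * (|g x| + |h x|)) →
      lebesgueModular A r f ≤
        ENNReal.ofReal K * (lebesgueModular A r g + lebesgueModular A r h) := by
  obtain ⟨K, hK, hpt⟩ := hr.exists_pointwise_bound hc
  obtain ⟨b, -, hrb⟩ := hr.exists_upper
  refine ⟨K, hK, fun f g h hg hfgh => ?_⟩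
  unfold lebesgueModular
  rw [← lintegral_add_left' (hr.aemeasurable_modular hg),
    ← lintegral_const_mul' _ _ ENNReal.ofReal_ne_top]
  refine lintegral_mono_ae ?_
  filter_upwards [hpt, hrb, hfgh] with x hx hrx h1
  have h0 : (0 : ℝ) ^ r x = 0 := Real.zero_rpow (by linarith [hrx.1])
  have := hx (f x) (g x) (h x) 0 0 (by simpa using h1)
  simpa [h0] using this

theorem IsExponentOn.modular_zero (hr : IsExponentOn A r) :
    lebesgueModular A r (fun _ => 0) = 0 := by
  obtain ⟨b, -, hrb⟩ := hr.exists_upper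
  unfold lebesgueModular
  rw [← lintegral_zero (μ := volume.restrict A)]
  refine lintegral_congr_ae ?_
  filter_upwards [hrb] with x hx
  simp [Real.zero_rpow (show r x ≠ 0 by linarith [hx.1])]

/-- Multiplication by a constant. -/
theorem IsExponentOn.exists_modular_bound_mul (hr : IsExponentOn A r) (c : ℝ) :
    ∃ K : ℝ, 0 < K ∧ ∀ f : α → ℝ,
      lebesgueModular A r (fun x => c * f x) ≤ ENNReal.ofReal K * lebesgueModular A r f := by
  obtain ⟨K, hK, h⟩ := hr.exists_modular_bound (le_max_right |c| 1)
  refine ⟨K, hK, fun f => ?_⟩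
  have := h (fun x => c * f x) (fun _ => 0) f aemeasurable_const (Filter.Eventually.of_forall
    fun x => by
      simp only [abs_mul, abs_zero, zero_add]
      exact mul_le_mul_of_nonneg_right (le_max_left _ _) (abs_nonneg _))
  simpa [hr.modular_zero] using this

theorem IsExponentOn.modular_mul_le (hr : IsExponentOn A r) {l : ℝ} (hl0 : 0 ≤ l) (hl1 : l ≤ 1)
    (f : α → ℝ) :
    lebesgueModular A r (fun x => l * f x) ≤ ENNReal.ofReal l * lebesgueModular A r f := by
  obtain ⟨b, -, hrb⟩ := hr.exists_upper
  unfold lebesgueModular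
  rw [← lintegral_const_mul' _ _ ENNReal.ofReal_ne_top]
  refine lintegral_mono_ae ?_
  filter_upwards [hrb] with x hx
  rw [← ENNReal.ofReal_mul hl0]
  refine ENNReal.ofReal_le_ofReal ?_
  rw [abs_mul, Real.mul_rpow (abs_nonneg _) (abs_nonneg _), abs_of_nonneg hl0]
  refine mul_le_mul_of_nonneg_right ?_ (by positivity)
  exact Real.rpow_le_self_of_le_one hl0 hl1 hx.1

/-- For an essentially bounded exponent, rescaling by `l⁻¹` costs only a constant factor in the
modular, so the scale in the definition may be taken to be `1`. -/
theorem IsExponentOn.memLebesgue_iff (hr : IsExponentOn A r) {f : α → ℝ} :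
    MemLebesgue A r f ↔ AEMeasurable f (volume.restrict A) ∧ lebesgueModular A r f < ∞ := by
  refine and_congr_right fun _ => ⟨?_, fun h => ⟨1, one_pos, by simpa using h⟩⟩
  rintro ⟨l, hl, h⟩
  obtain ⟨K, -, hK⟩ := hr.exists_modular_bound_mul l⁻¹
  have h1 := hK fun x => l * f x
  simp only [inv_mul_cancel_left₀ hl.ne'] at h1
  exact h1.trans_lt (ENNReal.mul_lt_top ENNReal.ofReal_lt_top h)

theorem luxemburgNorm_nonneg (f : α → ℝ) : 0 ≤ luxemburgNorm A r f :=
  Real.sInf_nonneg fun _ hl => hl.1.le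

theorem IsExponentOn.modular_le_of_luxemburgNorm_lt (hr : IsExponentOn A r) {f : α → ℝ}
    (hf : MemLebesgue A r f) {d : ℝ} (hd : d ≤ 1) (h : luxemburgNorm A r f < d) :
    lebesgueModular A r f ≤ ENNReal.ofReal d := by
  have hfin := (hr.memLebesgue_iff.1 hf).2
  -- Nonemptiness is needed to extract a scale `l < d` from the infimum. Since `r ≥ 1` a.e.,
  -- dividing `f` by `max m 1` divides the modular `m` by at least as much.
  have hne : {l : ℝ | 0 < l ∧ lebesgueModular A r (fun x => f x / l) ≤ 1}.Nonempty := by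
    set m := (lebesgueModular A r f).toReal with hm
    have hm0 : 0 ≤ m := ENNReal.toReal_nonneg
    have hm1 : (0 : ℝ) < max m 1 := lt_max_of_lt_right one_pos
    refine ⟨max m 1, hm1, ?_⟩
    have h1 := hr.modular_mul_le (inv_nonneg.2 hm1.le) (inv_le_one_of_one_le₀ (le_max_right _ _)) f
    simp only [inv_mul_eq_div] at h1
    refine h1.trans ?_
    rw [← ENNReal.ofReal_toReal hfin.ne, ← hm, ← ENNReal.ofReal_mul (inv_nonneg.2 hm1.le),
      ← ENNReal.ofReal_one]
    refine ENNReal.ofReal_le_ofReal ?_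
    rw [inv_mul_eq_div]
    exact div_le_one_of_le₀ (le_max_left _ _) hm1.le
  obtain ⟨l, ⟨hl0, hl⟩, hld⟩ := exists_lt_of_csInf_lt hne h
  have h1 := hr.modular_mul_le hl0.le (hld.le.trans hd) fun x => f x / l
  simp only [mul_div_cancel₀ _ hl0.ne'] at h1
  calc lebesgueModular A r f ≤ ENNReal.ofReal l * lebesgueModular A r (fun x => f x / l) := h1
    _ ≤ ENNReal.ofReal l * 1 := by gcongr
    _ ≤ ENNReal.ofReal d := by simpa using ENNReal.ofReal_le_ofReal hld.le

theorem IsExponentOn.exists_luxemburgNorm_le (hr : IsExponentOn A r) {l : ℝ} (hl : 0 < l) :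
    ∃ d : ℝ, 0 < d ∧ ∀ f : α → ℝ, lebesgueModular A r f ≤ ENNReal.ofReal d →
      luxemburgNorm A r f ≤ l := by
  obtain ⟨K, hK, h⟩ := hr.exists_modular_bound_mul l⁻¹
  refine ⟨K⁻¹, inv_pos.2 hK, fun f hf => csInf_le ⟨0, fun _ hx => hx.1.le⟩ ⟨hl, ?_⟩⟩
  have h1 := h f
  simp only [inv_mul_eq_div] at h1
  refine h1.trans ?_
  calc ENNReal.ofReal K * lebesgueModular A r f
      ≤ ENNReal.ofReal K * ENNReal.ofReal K⁻¹ := by gcongr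
    _ = 1 := by rw [← ENNReal.ofReal_mul hK.le, mul_inv_cancel₀ hK.ne', ENNReal.ofReal_one]

end Lebesgue

/-! ### The Sobolev modular and a modular criterion for membership in the closure. -/

section Sobolev

variable {n : ℕ} {Ω : Set (EuclideanSpace ℝ (Fin n))} {s : ℝ}
  {q : EuclideanSpace ℝ (Fin n) → ℝ}
  {p : EuclideanSpace ℝ (Fin n) × EuclideanSpace ℝ (Fin n) → ℝ}

theorem restrict_prod_self : (volume.restrict (Ω ×ˢ Ω) :
    Measure (EuclideanSpace ℝ (Fin n) × EuclideanSpace ℝ (Fin n))) =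
    (volume.restrict Ω).prod (volume.restrict Ω) := by
  rw [Measure.volume_eq_prod, Measure.prod_restrict]

theorem ae_prod_of_ae {P : EuclideanSpace ℝ (Fin n) → Prop}
    (h : ∀ᵐ x ∂(volume.restrict Ω), P x) :
    ∀ᵐ z ∂(volume.restrict (Ω ×ˢ Ω)), P z.1 ∧ P z.2 := by
  rw [restrict_prod_self]
  exact (Measure.quasiMeasurePreserving_fst.ae h).and (Measure.quasiMeasurePreserving_snd.ae h)

theorem aemeasurable_gagliardoQuotient (hp : IsExponentOn (Ω ×ˢ Ω) p)
    {u : EuclideanSpace ℝ (Fin n) → ℝ} (hu : AEMeasurable u (volume.restrict Ω)) :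
    AEMeasurable (gagliardoQuotient s p u) (volume.restrict (Ω ×ˢ Ω)) := by
  have h1 : AEMeasurable (fun z : EuclideanSpace ℝ (Fin n) × EuclideanSpace ℝ (Fin n) => u z.1)
      (volume.restrict (Ω ×ˢ Ω)) := by
    rw [restrict_prod_self]; exact hu.comp_fst
  have h2 : AEMeasurable (fun z : EuclideanSpace ℝ (Fin n) × EuclideanSpace ℝ (Fin n) => u z.2)
      (volume.restrict (Ω ×ˢ Ω)) := by
    rw [restrict_prod_self]; exact hu.comp_snd
  have h3 : Measurable (fun z : EuclideanSpace ℝ (Fin n) × EuclideanSpace ℝ (Fin n) =>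
      ‖z.1 - z.2‖) := by fun_prop
  exact (continuous_abs.measurable.comp_aemeasurable (h1.sub h2)).div
    (h3.aemeasurable.pow ((hp.aemeasurable.const_div _).const_add _))

theorem gagliardoQuotient_nonneg (u : EuclideanSpace ℝ (Fin n) → ℝ)
    (z : EuclideanSpace ℝ (Fin n) × EuclideanSpace ℝ (Fin n)) :
    0 ≤ gagliardoQuotient s p u z :=
  div_nonneg (abs_nonneg _) (Real.rpow_nonneg (norm_nonneg _) _)

theorem mem_sobolevSpace_iff (hq : IsExponentOn Ω q) (hp : IsExponentOn (Ω ×ˢ Ω) p)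
    {u : EuclideanSpace ℝ (Fin n) → ℝ} :
    u ∈ sobolevSpace Ω s q p ↔
      AEMeasurable u (volume.restrict Ω) ∧ sobolevModular Ω s q p u < ∞ := by
  unfold sobolevSpace sobolevModular
  rw [mem_ofPred_eq, hq.memLebesgue_iff, hp.memLebesgue_iff, ENNReal.add_lt_top]
  exact ⟨fun h => ⟨h.1.1, h.1.2, h.2.2⟩,
    fun h => ⟨⟨h.1, h.2.1⟩, aemeasurable_gagliardoQuotient hp h.1, h.2.2⟩⟩

/-- Lipschitz combinations in one estimate for the Gagliardo quotient. -/
theorem gagliardoQuotient_le {c : ℝ} {w u₁ u₂ u₃ u₄ : EuclideanSpace ℝ (Fin n) → ℝ}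
    {z : EuclideanSpace ℝ (Fin n) × EuclideanSpace ℝ (Fin n)}
    (h : |w z.1 - w z.2| ≤
      c * (|u₁ z.1 - u₁ z.2| + |u₂ z.1 - u₂ z.2| + |u₃ z.1 - u₃ z.2| + |u₄ z.1 - u₄ z.2|)) :
    |gagliardoQuotient s p w z| ≤ c * (|gagliardoQuotient s p u₁ z| +
      |gagliardoQuotient s p u₂ z| + |gagliardoQuotient s p u₃ z| +
      |gagliardoQuotient s p u₄ z|) := by
  simp only [abs_of_nonneg (gagliardoQuotient_nonneg _ _)]
  unfold gagliardoQuotient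
  rw [← add_div, ← add_div, ← add_div, ← mul_div_assoc]
  exact div_le_div_of_nonneg_right h (Real.rpow_nonneg (norm_nonneg _) _)

theorem exists_sobolevModular_bound (hq : IsExponentOn Ω q) (hp : IsExponentOn (Ω ×ˢ Ω) p)
    (s : ℝ) {c : ℝ} (hc : 1 ≤ c) :
    ∃ K : ℝ, 0 < K ∧ ∀ w u₁ u₂ : EuclideanSpace ℝ (Fin n) → ℝ,
      AEMeasurable u₁ (volume.restrict Ω) →
      (∀ᵐ x ∂(volume.restrict Ω), |w x| ≤ c * (|u₁ x| + |u₂ x|)) →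
      (∀ᵐ z ∂(volume.restrict (Ω ×ˢ Ω)),
        |w z.1 - w z.2| ≤ c * (|u₁ z.1 - u₁ z.2| + |u₂ z.1 - u₂ z.2|)) →
      sobolevModular Ω s q p w ≤
        ENNReal.ofReal K * (sobolevModular Ω s q p u₁ + sobolevModular Ω s q p u₂) := by
  obtain ⟨K₁, hK₁, h₁⟩ := hq.exists_modular_bound hc
  obtain ⟨K₂, hK₂, h₂⟩ := hp.exists_modular_bound hc
  refine ⟨max K₁ K₂, lt_max_of_lt_left hK₁, fun w u₁ u₂ hu hw hD => ?_⟩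
  have e₁ := h₁ w u₁ u₂ hu hw
  have e₂ := h₂ (gagliardoQuotient s p w) (gagliardoQuotient s p u₁) (gagliardoQuotient s p u₂)
    (aemeasurable_gagliardoQuotient hp hu) (by
      filter_upwards [hD] with z hz
      have := gagliardoQuotient_le (s := s) (p := p) (w := w) (u₁ := u₁) (u₂ := u₂)
        (u₃ := fun _ => 0) (u₄ := fun _ => 0) (z := z) (c := c) (by simpa using hz)
      simpa [gagliardoQuotient] using this)
  have g₁ : ENNReal.ofReal K₁ ≤ ENNReal.ofReal (max K₁ K₂) :=
    ENNReal.ofReal_le_ofReal (le_max_left _ _)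
  have g₂ : ENNReal.ofReal K₂ ≤ ENNReal.ofReal (max K₁ K₂) :=
    ENNReal.ofReal_le_ofReal (le_max_right _ _)
  calc sobolevModular Ω s q p w ≤ _ := add_le_add e₁ e₂
    _ ≤ ENNReal.ofReal (max K₁ K₂) * _ + ENNReal.ofReal (max K₁ K₂) * _ := by gcongr
    _ = _ := by unfold sobolevModular; ring

theorem sub_mem_sobolevSpace (hq : IsExponentOn Ω q) (hp : IsExponentOn (Ω ×ˢ Ω) p)
    {u v : EuclideanSpace ℝ (Fin n) → ℝ} (hu : u ∈ sobolevSpace Ω s q p)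
    (hv : v ∈ sobolevSpace Ω s q p) : (fun x => u x - v x) ∈ sobolevSpace Ω s q p := by
  rw [mem_sobolevSpace_iff hq hp] at *
  refine ⟨hu.1.sub hv.1, ?_⟩
  obtain ⟨K, -, h⟩ := exists_sobolevModular_bound hq hp s le_rfl
  refine (h _ u v hu.1 (Filter.Eventually.of_forall fun x => ?_)
    (Filter.Eventually.of_forall fun z => ?_)).trans_lt
    (ENNReal.mul_lt_top ENNReal.ofReal_lt_top (ENNReal.add_lt_top.2 ⟨hu.2, hv.2⟩))
  · simpa using abs_sub (u x) (v x)
  · rw [one_mul, show u z.1 - v z.1 - (u z.2 - v z.2) = (u z.1 - u z.2) - (v z.1 - v z.2) by ring]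
    exact abs_sub _ _

/-- Membership in `sobolevTilde` can be tested with modulars instead of norms. -/
theorem mem_sobolevTilde_iff (hq : IsExponentOn Ω q) (hp : IsExponentOn (Ω ×ˢ Ω) p)
    {u : EuclideanSpace ℝ (Fin n) → ℝ} :
    u ∈ sobolevTilde Ω s q p ↔ u ∈ sobolevSpace Ω s q p ∧ ∀ ε : ℝ, 0 < ε →
      ∃ φ ∈ sobolevSpace Ω s q p ∩ ccClosure Ω,
        sobolevModular Ω s q p (fun x => u x - φ x) ≤ ENNReal.ofReal ε := by
  refine and_congr_right fun hu => ⟨fun h ε hε => ?_, fun h ε hε => ?_⟩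
  -- The cap at `1` is there because the norm dominates the modular only below `1`.
  · obtain ⟨φ, hφ, hlt⟩ := h (min (ε / 2) 1) (by positivity)
    refine ⟨φ, hφ, ?_⟩
    have hmem := sub_mem_sobolevSpace hq hp hu hφ.1
    have n₁ := luxemburgNorm_nonneg (A := Ω) (r := q) (fun x => u x - φ x)
    have n₂ := luxemburgNorm_nonneg (A := Ω ×ˢ Ω) (r := p)
      (gagliardoQuotient s p fun x => u x - φ x)
    unfold sobolevNorm at hlt
    have h₁ := hq.modular_le_of_luxemburgNorm_lt hmem.1 (min_le_right (ε / 2) 1) (by linarith)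
    have h₂ := hp.modular_le_of_luxemburgNorm_lt hmem.2 (min_le_right (ε / 2) 1) (by linarith)
    refine (add_le_add h₁ h₂).trans ?_
    rw [← ENNReal.ofReal_add (by positivity) (by positivity)]
    exact ENNReal.ofReal_le_ofReal (by linarith [min_le_left (ε / 2) 1])
  -- The two norm bounds are non-strict; thirds leave room for the strict `< ε`.
  · obtain ⟨d₁, hd₁, h₁⟩ := hq.exists_luxemburgNorm_le (l := ε / 3) (by positivity)
    obtain ⟨d₂, hd₂, h₂⟩ := hp.exists_luxemburgNorm_le (l := ε / 3) (by positivity)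
    obtain ⟨φ, hφ, hle⟩ := h (min d₁ d₂) (lt_min hd₁ hd₂)
    refine ⟨φ, hφ, ?_⟩
    unfold sobolevModular at hle
    have e₁ := h₁ (fun x => u x - φ x) ((le_self_add.trans hle).trans
      (ENNReal.ofReal_le_ofReal (min_le_left _ _)))
    have e₂ := h₂ (gagliardoQuotient s p fun x => u x - φ x) ((le_add_self.trans hle).trans
      (ENNReal.ofReal_le_ofReal (min_le_right _ _)))
    unfold sobolevNorm
    linarith

/-! ### Convergence almost everywhere and convergence of Gagliardo modulars. -/

theorem ae_tendsto_zero_of_modular_le (hq : IsExponentOn Ω q)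
    {f : ℕ → EuclideanSpace ℝ (Fin n) → ℝ} (hf : ∀ k, AEMeasurable (f k) (volume.restrict Ω))
    (hle : ∀ k, lebesgueModular Ω q (f k) ≤ ENNReal.ofReal ((1 / 2) ^ k)) :
    ∀ᵐ x ∂(volume.restrict Ω), Filter.Tendsto (fun k => f k x) Filter.atTop (nhds 0) := by
  obtain ⟨b, -, hqb⟩ := hq.exists_upper
  -- The geometric rate makes the modulars summable, so the series of integrands is finite a.e. and
  -- its terms tend to zero without passing to a subsequence.
  have hsum : ∑' k, lebesgueModular Ω q (f k) ≠ ∞ := by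
    refine ne_top_of_le_ne_top ?_ (ENNReal.tsum_le_tsum hle)
    rw [← ENNReal.ofReal_tsum_of_nonneg (fun k => by positivity) summable_geometric_two]
    exact ENNReal.ofReal_ne_top
  unfold lebesgueModular at hsum
  rw [← lintegral_tsum fun k => hq.aemeasurable_modular (hf k)] at hsum
  have hmeas : AEMeasurable (fun x => ∑' k, ENNReal.ofReal (|f k x| ^ q x))
      (volume.restrict Ω) := AEMeasurable.tsum fun k => hq.aemeasurable_modular (hf k)
  filter_upwards [ae_lt_top' hmeas hsum, hqb] with x hx hqx
  have hq0 : 0 < q x := by linarith [hqx.1]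
  have h1 := ENNReal.tendsto_atTop_zero_of_tsum_ne_top hx.ne
  have h2 := (ENNReal.tendsto_toReal ENNReal.zero_ne_top).comp h1
  have h3 : Filter.Tendsto (fun k => |f k x| ^ q x) Filter.atTop (nhds 0) := by
    refine h2.congr fun k => ?_
    exact ENNReal.toReal_ofReal (by positivity)
  have h4 := h3.rpow_const (p := (q x)⁻¹) (Or.inr (by positivity))
  rw [Real.zero_rpow (by positivity)] at h4
  rw [tendsto_zero_iff_abs_tendsto_zero]
  refine h4.congr fun k => ?_
  exact Real.rpow_rpow_inv (abs_nonneg _) hq0.ne'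

/-- Generalized dominated convergence for Gagliardo modulars. -/
theorem tendsto_gagliardo_modular (hp : IsExponentOn (Ω ×ˢ Ω) p)
    {c : ℝ} (hc : 1 ≤ c) {g e₁ e₂ : ℕ → EuclideanSpace ℝ (Fin n) → ℝ}
    {u₁ u₂ : EuclideanSpace ℝ (Fin n) → ℝ}
    (hg : ∀ k, AEMeasurable (g k) (volume.restrict Ω))
    (he₁ : ∀ k, AEMeasurable (e₁ k) (volume.restrict Ω))
    (hu₁ : AEMeasurable u₁ (volume.restrict Ω)) (hu₂ : AEMeasurable u₂ (volume.restrict Ω))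
    (h₁ : Filter.Tendsto (fun k => lebesgueModular (Ω ×ˢ Ω) p (gagliardoQuotient s p (e₁ k)))
      Filter.atTop (nhds 0))
    (h₂ : Filter.Tendsto (fun k => lebesgueModular (Ω ×ˢ Ω) p (gagliardoQuotient s p (e₂ k)))
      Filter.atTop (nhds 0))
    (hf₁ : lebesgueModular (Ω ×ˢ Ω) p (gagliardoQuotient s p u₁) < ∞)
    (hf₂ : lebesgueModular (Ω ×ˢ Ω) p (gagliardoQuotient s p u₂) < ∞)
    (hlim : ∀ᵐ x ∂(volume.restrict Ω), Filter.Tendsto (fun k => g k x) Filter.atTop (nhds 0))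
    (hle : ∀ k, ∀ᵐ z ∂(volume.restrict (Ω ×ˢ Ω)), |g k z.1 - g k z.2| ≤
      c * (|e₁ k z.1 - e₁ k z.2| + |e₂ k z.1 - e₂ k z.2| + |u₁ z.1 - u₁ z.2| +
        |u₂ z.1 - u₂ z.2|)) :
    Filter.Tendsto (fun k => lebesgueModular (Ω ×ˢ Ω) p (gagliardoQuotient s p (g k)))
      Filter.atTop (nhds 0) := by
  obtain ⟨K, -, hK⟩ := hp.exists_pointwise_bound hc
  obtain ⟨b, -, hpb⟩ := hp.exists_upper
  let m : (EuclideanSpace ℝ (Fin n) → ℝ) →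
      EuclideanSpace ℝ (Fin n) × EuclideanSpace ℝ (Fin n) → ℝ≥0∞ :=
    fun u z => ENNReal.ofReal (|gagliardoQuotient s p u z| ^ p z)
  have hm : ∀ u : EuclideanSpace ℝ (Fin n) → ℝ, AEMeasurable u (volume.restrict Ω) →
      AEMeasurable (m u) (volume.restrict (Ω ×ˢ Ω)) := fun u hu =>
    hp.aemeasurable_modular (aemeasurable_gagliardoQuotient hp hu)
  let B : EuclideanSpace ℝ (Fin n) × EuclideanSpace ℝ (Fin n) → ℝ≥0∞ :=
    fun z => ENNReal.ofReal K * (m u₁ z + m u₂ z)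
  have hB : ∫⁻ z in Ω ×ˢ Ω, B z ≠ ∞ := by
    rw [lintegral_const_mul' _ _ ENNReal.ofReal_ne_top, lintegral_add_left' (hm _ hu₁)]
    exact (ENNReal.mul_lt_top ENNReal.ofReal_lt_top (ENNReal.add_lt_top.2 ⟨hf₁, hf₂⟩)).ne
  have hBm : ∀ k, AEMeasurable (fun z => min (m (g k) z) (B z)) (volume.restrict (Ω ×ˢ Ω)) := by
    exact fun k => (hm _ (hg k)).min (((hm _ hu₁).add (hm _ hu₂)).const_mul _)
  have hmin : Filter.Tendsto (fun k => ∫⁻ z in Ω ×ˢ Ω, min (m (g k) z) (B z)) Filter.atTop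
      (nhds 0) := by
    have := tendsto_lintegral_of_dominated_convergence' (μ := volume.restrict (Ω ×ˢ Ω))
      (F := fun k z => min (m (g k) z) (B z)) (f := fun _ => 0) B hBm
      (fun k => Filter.Eventually.of_forall fun z => min_le_right _ _) hB ?_
    · simpa using this
    · filter_upwards [ae_prod_of_ae hlim, hpb] with z hz hpz
      have hp0 : 0 < p z := by linarith [hpz.1]
      have t₁ : Filter.Tendsto (fun k => gagliardoQuotient s p (g k) z) Filter.atTop
          (nhds 0) := by
        simpa [gagliardoQuotient] using
          ((hz.1.sub hz.2).abs.div_const (‖z.1 - z.2‖ ^ (s + (n : ℝ) / p z)))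
      have t₂ := t₁.abs.rpow_const (p := p z) (Or.inr hp0.le)
      rw [abs_zero, Real.zero_rpow hp0.ne'] at t₂
      have t₃ := ENNReal.tendsto_ofReal t₂
      rw [ENNReal.ofReal_zero] at t₃
      exact tendsto_of_tendsto_of_tendsto_of_le_of_le tendsto_const_nhds t₃
        (fun _ => zero_le) (fun k => min_le_left _ _)
  -- The integrand of `g k` has no fixed majorant, but the part of it above the integrable function
  -- `B` is bounded by the error terms, whose integrals vanish in the limit. The part below is the
  -- minimum with `B`, handled by dominated convergence.
  have hbound : ∀ k, lebesgueModular (Ω ×ˢ Ω) p (gagliardoQuotient s p (g k)) ≤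
      ENNReal.ofReal K * (lebesgueModular (Ω ×ˢ Ω) p (gagliardoQuotient s p (e₁ k)) +
        lebesgueModular (Ω ×ˢ Ω) p (gagliardoQuotient s p (e₂ k))) +
      ∫⁻ z in Ω ×ˢ Ω, min (m (g k) z) (B z) := by
    intro k
    unfold lebesgueModular
    rw [← lintegral_add_left' (hm _ (he₁ k)), ← lintegral_const_mul' _ _ ENNReal.ofReal_ne_top,
      ← lintegral_add_right' _ (hBm k)]
    refine lintegral_mono_ae ?_
    filter_upwards [hK, hle k] with z hKz hz
    have h := hKz _ _ _ _ _ (gagliardoQuotient_le (s := s) (p := p) hz)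
    change m (g k) z ≤ ENNReal.ofReal K * (m (e₁ k) z + m (e₂ k) z) + min (m (g k) z) (B z)
    rcases le_total (m (g k) z) (B z) with h' | h'
    · rw [min_eq_left h']
      exact le_add_self
    · rw [min_eq_right h', ← mul_add]
      exact h
  have hlim0 := (ENNReal.Tendsto.const_mul (h₁.add h₂)
    (Or.inr (ENNReal.ofReal_ne_top (r := K)))).add hmin
  simp only [add_zero, mul_zero] at hlim0
  exact tendsto_of_tendsto_of_tendsto_of_le_of_le tendsto_const_nhds hlim0
    (fun _ => zero_le) hbound

/-! ### Composition with Lipschitz functions of two variables. -/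

theorem continuous_of_abs_sub_le {F : ℝ → ℝ → ℝ} {c : ℝ}
    (hF : ∀ a b a' b', |F a b - F a' b'| ≤ c * (|a - a'| + |b - b'|)) :
    Continuous fun z : ℝ × ℝ => F z.1 z.2 := by
  refine continuous_iff_continuousAt.2 fun z₀ => ?_
  refine tendsto_iff_dist_tendsto_zero.2 ?_
  refine squeeze_zero (fun _ => dist_nonneg) (fun z => hF z.1 z.2 z₀.1 z₀.2) ?_
  have : Continuous fun z : ℝ × ℝ => c * (|z.1 - z₀.1| + |z.2 - z₀.2|) := by fun_prop
  simpa using this.tendsto z₀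

theorem comp_mem_sobolevSpace (hq : IsExponentOn Ω q) (hp : IsExponentOn (Ω ×ˢ Ω) p)
    {F : ℝ → ℝ → ℝ} {c : ℝ} (hc : 1 ≤ c) (hF0 : F 0 0 = 0)
    (hF : ∀ a b a' b', |F a b - F a' b'| ≤ c * (|a - a'| + |b - b'|))
    {u v w : EuclideanSpace ℝ (Fin n) → ℝ} (hu : u ∈ sobolevSpace Ω s q p)
    (hv : v ∈ sobolevSpace Ω s q p)
    (hw : ∀ᵐ x ∂(volume.restrict Ω), w x = F (u x) (v x)) : w ∈ sobolevSpace Ω s q p := by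
  rw [mem_sobolevSpace_iff hq hp] at *
  refine ⟨((continuous_of_abs_sub_le hF).measurable.comp_aemeasurable
    (hu.1.prodMk hv.1)).congr (hw.mono fun _ h => h.symm), ?_⟩
  obtain ⟨K, -, h⟩ := exists_sobolevModular_bound hq hp s hc
  refine (h _ u v hu.1 ?_ ?_).trans_lt
    (ENNReal.mul_lt_top ENNReal.ofReal_lt_top (ENNReal.add_lt_top.2 ⟨hu.2, hv.2⟩))
  · filter_upwards [hw] with x hx
    rw [hx]
    simpa [hF0] using hF (u x) (v x) 0 0
  · filter_upwards [ae_prod_of_ae hw] with z hz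
    rw [hz.1, hz.2]
    exact hF _ _ _ _

theorem comp_mem_ccClosure {F : ℝ → ℝ → ℝ} {c : ℝ} (hF0 : F 0 0 = 0)
    (hF : ∀ a b a' b', |F a b - F a' b'| ≤ c * (|a - a'| + |b - b'|))
    {φ ψ : EuclideanSpace ℝ (Fin n) → ℝ} (hφ : φ ∈ ccClosure Ω) (hψ : ψ ∈ ccClosure Ω) :
    (fun x => F (φ x) (ψ x)) ∈ ccClosure Ω := by
  obtain ⟨hφc, K₁, hK₁, hs₁, h₁⟩ := hφ
  obtain ⟨hψc, K₂, hK₂, hs₂, h₂⟩ := hψ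
  refine ⟨(continuous_of_abs_sub_le hF).comp_continuousOn (hφc.prodMk hψc), K₁ ∪ K₂,
    hK₁.union hK₂, union_subset hs₁ hs₂, fun x hx => ?_⟩
  have hx' := not_or.1 hx.2
  simp only [h₁ x ⟨hx.1, hx'.1⟩, h₂ x ⟨hx.1, hx'.2⟩, hF0]

theorem tendsto_ofReal_half_pow :
    Filter.Tendsto (fun k : ℕ => ENNReal.ofReal ((1 / 2) ^ k)) Filter.atTop (nhds 0) := by
  have := ENNReal.tendsto_ofReal
    (tendsto_pow_atTop_nhds_zero_of_lt_one (r := (1 / 2 : ℝ)) (by norm_num) (by norm_num))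
  simpa using this

/-- `sobolevTilde` is stable under Lipschitz functions of two variables vanishing at the origin. -/
theorem comp_mem_sobolevTilde (hq : IsExponentOn Ω q) (hp : IsExponentOn (Ω ×ˢ Ω) p)
    {F : ℝ → ℝ → ℝ} {c : ℝ} (hc : 1 ≤ c) (hF0 : F 0 0 = 0)
    (hF : ∀ a b a' b', |F a b - F a' b'| ≤ c * (|a - a'| + |b - b'|))
    {u v w : EuclideanSpace ℝ (Fin n) → ℝ} (hu : u ∈ sobolevTilde Ω s q p)
    (hv : v ∈ sobolevTilde Ω s q p)
    (hw : ∀ᵐ x ∂(volume.restrict Ω), w x = F (u x) (v x)) : w ∈ sobolevTilde Ω s q p := by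
  rw [mem_sobolevTilde_iff hq hp] at *
  obtain ⟨hu, hu'⟩ := hu
  obtain ⟨hv, hv'⟩ := hv
  have hws := comp_mem_sobolevSpace hq hp hc hF0 hF hu hv hw
  refine ⟨hws, ?_⟩
  choose φ hφ hφle using fun k : ℕ => hu' ((1 / 2) ^ k) (by positivity)
  choose ψ hψ hψle using fun k : ℕ => hv' ((1 / 2) ^ k) (by positivity)
  have hχ : ∀ k, (fun x => F (φ k x) (ψ k x)) ∈ sobolevSpace Ω s q p ∩ ccClosure Ω := fun k =>
    ⟨comp_mem_sobolevSpace hq hp hc hF0 hF (hφ k).1 (hψ k).1 (Filter.Eventually.of_forall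
      fun _ => rfl), comp_mem_ccClosure hF0 hF (hφ k).2 (hψ k).2⟩
  let e₁ : ℕ → EuclideanSpace ℝ (Fin n) → ℝ := fun k x => u x - φ k x
  let e₂ : ℕ → EuclideanSpace ℝ (Fin n) → ℝ := fun k x => v x - ψ k x
  let g : ℕ → EuclideanSpace ℝ (Fin n) → ℝ := fun k x => w x - F (φ k x) (ψ k x)
  have hm : ∀ {f : EuclideanSpace ℝ (Fin n) → ℝ}, f ∈ sobolevSpace Ω s q p →
      AEMeasurable f (volume.restrict Ω) := fun hf => hf.1.1
  have he₁ : ∀ k, AEMeasurable (e₁ k) (volume.restrict Ω) := fun k => (hm hu).sub (hm (hφ k).1)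
  have he₂ : ∀ k, AEMeasurable (e₂ k) (volume.restrict Ω) := fun k => (hm hv).sub (hm (hψ k).1)
  have hg : ∀ k, AEMeasurable (g k) (volume.restrict Ω) := fun k => (hm hws).sub (hm (hχ k).1)
  have hgle : ∀ᵐ x ∂(volume.restrict Ω), ∀ k, |g k x| ≤ c * (|e₁ k x| + |e₂ k x|) := by
    filter_upwards [hw] with x hx k
    simp only [g, hx]
    exact hF _ _ _ _
  have l₁ : Filter.Tendsto (fun k => lebesgueModular Ω q (e₁ k)) Filter.atTop (nhds 0) :=
    tendsto_of_tendsto_of_tendsto_of_le_of_le tendsto_const_nhds tendsto_ofReal_half_pow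
      (fun _ => zero_le) (fun k => le_self_add.trans (hφle k))
  have l₂ : Filter.Tendsto (fun k => lebesgueModular Ω q (e₂ k)) Filter.atTop (nhds 0) :=
    tendsto_of_tendsto_of_tendsto_of_le_of_le tendsto_const_nhds tendsto_ofReal_half_pow
      (fun _ => zero_le) (fun k => le_self_add.trans (hψle k))
  have d₁ : Filter.Tendsto (fun k => lebesgueModular (Ω ×ˢ Ω) p (gagliardoQuotient s p (e₁ k)))
      Filter.atTop (nhds 0) :=
    tendsto_of_tendsto_of_tendsto_of_le_of_le tendsto_const_nhds tendsto_ofReal_half_pow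
      (fun _ => zero_le) (fun k => le_add_self.trans (hφle k))
  have d₂ : Filter.Tendsto (fun k => lebesgueModular (Ω ×ˢ Ω) p (gagliardoQuotient s p (e₂ k)))
      Filter.atTop (nhds 0) :=
    tendsto_of_tendsto_of_tendsto_of_le_of_le tendsto_const_nhds tendsto_ofReal_half_pow
      (fun _ => zero_le) (fun k => le_add_self.trans (hψle k))
  have hlim : ∀ᵐ x ∂(volume.restrict Ω),
      Filter.Tendsto (fun k => g k x) Filter.atTop (nhds 0) := by
    filter_upwards [hgle, ae_tendsto_zero_of_modular_le hq he₁
      fun k => le_self_add.trans (hφle k), ae_tendsto_zero_of_modular_le hq he₂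
      fun k => le_self_add.trans (hψle k)] with x hx h₁ h₂
    refine squeeze_zero_norm hx ?_
    simpa using (h₁.abs.add h₂.abs).const_mul c
  have lg : Filter.Tendsto (fun k => lebesgueModular Ω q (g k)) Filter.atTop (nhds 0) := by
    obtain ⟨K, -, hK⟩ := hq.exists_modular_bound hc
    have h0 := ENNReal.Tendsto.const_mul (l₁.add l₂) (Or.inr (ENNReal.ofReal_ne_top (r := K)))
    simp only [add_zero, mul_zero] at h0
    exact tendsto_of_tendsto_of_tendsto_of_le_of_le tendsto_const_nhds h0
      (fun _ => zero_le) (fun k => hK _ _ _ (he₁ k) (hgle.mono fun x hx => hx k))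
  -- The increment of `g k` is split into those of `F (u, v)` and `F (φ k, ψ k)`. Increments of `φ
  -- k` and `ψ k` are bounded by those of `u`, `v` and the errors, so `u` and `v` are counted twice,
  -- whence `2 * c`.
  have dg := tendsto_gagliardo_modular (s := s) (c := 2 * c) hp (by linarith) hg he₁ (hm hu)
    (hm hv) d₁ d₂ (hp.memLebesgue_iff.1 hu.2).2 (hp.memLebesgue_iff.1 hv.2).2 hlim (by
      intro k
      filter_upwards [ae_prod_of_ae hw] with z hz
      have i₁ := hF (u z.1) (v z.1) (u z.2) (v z.2)
      have i₂ := hF (φ k z.1) (ψ k z.1) (φ k z.2) (ψ k z.2)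
      have i₃ : |φ k z.1 - φ k z.2| ≤ |u z.1 - u z.2| + |e₁ k z.1 - e₁ k z.2| := by
        rw [show φ k z.1 - φ k z.2 = (u z.1 - u z.2) - (e₁ k z.1 - e₁ k z.2) by
          simp only [e₁]; ring]
        exact abs_sub _ _
      have i₄ : |ψ k z.1 - ψ k z.2| ≤ |v z.1 - v z.2| + |e₂ k z.1 - e₂ k z.2| := by
        rw [show ψ k z.1 - ψ k z.2 = (v z.1 - v z.2) - (e₂ k z.1 - e₂ k z.2) by
          simp only [e₂]; ring]
        exact abs_sub _ _
      have i₅ : |g k z.1 - g k z.2| ≤ |F (u z.1) (v z.1) - F (u z.2) (v z.2)| +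
          |F (φ k z.1) (ψ k z.1) - F (φ k z.2) (ψ k z.2)| := by
        rw [show g k z.1 - g k z.2 = (F (u z.1) (v z.1) - F (u z.2) (v z.2)) -
          (F (φ k z.1) (ψ k z.1) - F (φ k z.2) (ψ k z.2)) by
            simp only [g, hz.1, hz.2]; ring]
        exact abs_sub _ _
      have j₁ := abs_nonneg (e₁ k z.1 - e₁ k z.2)
      have j₂ := abs_nonneg (e₂ k z.1 - e₂ k z.2)
      have i₆ := mul_le_mul_of_nonneg_left (add_le_add i₃ i₄) (show 0 ≤ c by linarith)
      have i₇ := mul_nonneg (show 0 ≤ c by linarith) (add_nonneg j₁ j₂)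
      linarith)
  have htot := lg.add dg
  rw [add_zero] at htot
  intro ε hε
  obtain ⟨k, hk⟩ := (htot.eventually_le_const (ENNReal.ofReal_pos.2 hε)).exists
  exact ⟨_, hχ k, hk⟩

/-! ### Maxima, subadditivity of capacity and products of quasicontinuous functions. -/

theorem ofReal_rpow_le_add {x a b t : ℝ} (hx : |x| ≤ max |a| |b|) (ht : 0 ≤ t) :
    ENNReal.ofReal (|x| ^ t) ≤ ENNReal.ofReal (|a| ^ t) + ENNReal.ofReal (|b| ^ t) := by
  rcases le_max_iff.1 hx with h | h
  · exact (ENNReal.ofReal_le_ofReal (Real.rpow_le_rpow (abs_nonneg _) h ht)).trans le_self_add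
  · exact (ENNReal.ofReal_le_ofReal (Real.rpow_le_rpow (abs_nonneg _) h ht)).trans le_add_self

/-- Both `|max u v|` and the increments of `max u v` are bounded by the larger of the two
corresponding quantities, and a power of a maximum is at most the sum of the powers. The constant
`1` is what yields subadditivity of the capacity. -/
theorem sobolevModular_max_le (hq : IsExponentOn Ω q) (hp : IsExponentOn (Ω ×ˢ Ω) p)
    {u v : EuclideanSpace ℝ (Fin n) → ℝ} (hu : AEMeasurable u (volume.restrict Ω)) :
    sobolevModular Ω s q p (fun x => max (u x) (v x)) ≤
      sobolevModular Ω s q p u + sobolevModular Ω s q p v := by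
  obtain ⟨b, -, hqb⟩ := hq.exists_upper
  obtain ⟨b', -, hpb⟩ := hp.exists_upper
  have h₁ : lebesgueModular Ω q (fun x => max (u x) (v x)) ≤
      lebesgueModular Ω q u + lebesgueModular Ω q v := by
    unfold lebesgueModular
    rw [← lintegral_add_left' (hq.aemeasurable_modular hu)]
    refine lintegral_mono_ae ?_
    filter_upwards [hqb] with x hx
    exact ofReal_rpow_le_add abs_max_le_max_abs_abs (by linarith [hx.1])
  have h₂ : lebesgueModular (Ω ×ˢ Ω) p (gagliardoQuotient s p fun x => max (u x) (v x)) ≤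
      lebesgueModular (Ω ×ˢ Ω) p (gagliardoQuotient s p u) +
        lebesgueModular (Ω ×ˢ Ω) p (gagliardoQuotient s p v) := by
    unfold lebesgueModular
    rw [← lintegral_add_left' (hp.aemeasurable_modular (aemeasurable_gagliardoQuotient hp hu))]
    refine lintegral_mono_ae ?_
    filter_upwards [hpb] with z hz
    refine ofReal_rpow_le_add ?_ (by linarith [hz.1])
    simp only [abs_of_nonneg (gagliardoQuotient_nonneg _ _)]
    unfold gagliardoQuotient
    rw [max_div_div_right (Real.rpow_nonneg (norm_nonneg _) _)]
    exact div_le_div_of_nonneg_right (abs_max_sub_max_le_max _ _ _ _)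
      (Real.rpow_nonneg (norm_nonneg _) _)
  refine (add_le_add h₁ h₂).trans (le_of_eq ?_)
  unfold sobolevModular
  ring

theorem max_mem_sobolevTilde (hq : IsExponentOn Ω q) (hp : IsExponentOn (Ω ×ˢ Ω) p)
    {u v : EuclideanSpace ℝ (Fin n) → ℝ} (hu : u ∈ sobolevTilde Ω s q p)
    (hv : v ∈ sobolevTilde Ω s q p) :
    (fun x => max (u x) (v x)) ∈ sobolevTilde Ω s q p := by
  refine comp_mem_sobolevTilde hq hp (F := max) le_rfl (max_self 0) (fun a b a' b' => ?_) hu hv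
    (Filter.Eventually.of_forall fun _ => rfl)
  rw [one_mul]
  exact (abs_max_sub_max_le_max a b a' b').trans
    (max_le_add_of_nonneg (abs_nonneg _) (abs_nonneg _))

theorem IsRelOpen.union {O₁ O₂ : Set (EuclideanSpace ℝ (Fin n))} (h₁ : IsRelOpen Ω O₁)
    (h₂ : IsRelOpen Ω O₂) : IsRelOpen Ω (O₁ ∪ O₂) := by
  obtain ⟨U₁, hU₁, rfl⟩ := h₁
  obtain ⟨U₂, hU₂, rfl⟩ := h₂
  exact ⟨U₁ ∪ U₂, hU₁.union hU₂, (union_inter_distrib_right _ _ _).symm⟩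

theorem relCapacity_union_lt (hq : IsExponentOn Ω q) (hp : IsExponentOn (Ω ×ˢ Ω) p)
    {O₁ O₂ : Set (EuclideanSpace ℝ (Fin n))} {ε₁ ε₂ : ℝ≥0∞}
    (h₁ : relCapacity Ω s q p O₁ < ε₁) (h₂ : relCapacity Ω s q p O₂ < ε₂) :
    relCapacity Ω s q p (O₁ ∪ O₂) < ε₁ + ε₂ := by
  unfold relCapacity relCapacityOpen at h₁ h₂
  simp only [iInf_lt_iff] at h₁ h₂
  obtain ⟨V₁, ⟨hV₁, hs₁⟩, w₁, ⟨hw₁, hge₁⟩, hlt₁⟩ := h₁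
  obtain ⟨V₂, ⟨hV₂, hs₂⟩, w₂, ⟨hw₂, hge₂⟩, hlt₂⟩ := h₂
  -- The maximum of the two near-optimal test functions is admissible for `V₁ ∪ V₂`.
  refine lt_of_le_of_lt ?_ (ENNReal.add_lt_add hlt₁ hlt₂)
  refine le_trans ?_ (sobolevModular_max_le hq hp hw₁.1.1.1)
  unfold relCapacity relCapacityOpen
  refine iInf₂_le_of_le (V₁ ∪ V₂) ⟨hV₁.union hV₂, union_subset_union hs₁ hs₂⟩
    (iInf₂_le_of_le _ ⟨max_mem_sobolevTilde hq hp hw₁ hw₂, ?_⟩ le_rfl)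
  rw [union_inter_distrib_right, ae_restrict_union_iff]
  exact ⟨hge₁.mono fun _ h => le_max_of_le_left h, hge₂.mono fun _ h => le_max_of_le_right h⟩

theorem IsRelQuasicontinuous.mul (hq : IsExponentOn Ω q) (hp : IsExponentOn (Ω ×ˢ Ω) p)
    {u v : EuclideanSpace ℝ (Fin n) → ℝ} (hu : IsRelQuasicontinuous Ω s q p u)
    (hv : IsRelQuasicontinuous Ω s q p v) :
    IsRelQuasicontinuous Ω s q p (fun x => u x * v x) := by
  intro ε hε
  obtain ⟨O₁, hO₁, hc₁, hu⟩ := hu (ε / 2) (half_pos hε)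
  obtain ⟨O₂, hO₂, hc₂, hv⟩ := hv (ε / 2) (half_pos hε)
  refine ⟨O₁ ∪ O₂, hO₁.union hO₂, ?_, ?_⟩
  · have := relCapacity_union_lt hq hp hc₁ hc₂
    rwa [← ENNReal.ofReal_add (half_pos hε).le (half_pos hε).le, add_halves] at this
  · exact (hu.mono (sdiff_subset_sdiff_right subset_union_left)).mul
      (hv.mono (sdiff_subset_sdiff_right subset_union_right))

/-! ### Products of bounded functions via truncation. -/

theorem abs_clamp_mul_clamp_sub_le {M : ℝ} (hM : 0 ≤ M) (a b a' b' : ℝ) :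
    |max (-M) (min a M) * max (-M) (min b M) - max (-M) (min a' M) * max (-M) (min b' M)| ≤
      M * (|a - a'| + |b - b'|) := by
  have hb : ∀ t : ℝ, |max (-M) (min t M)| ≤ M := fun t =>
    abs_le.2 ⟨le_max_left _ _, max_le (by linarith) (min_le_right _ _)⟩
  have hl : ∀ t t' : ℝ, |max (-M) (min t M) - max (-M) (min t' M)| ≤ |t - t'| := by
    intro t t'
    refine (abs_max_sub_max_le_max _ _ _ _).trans ?_
    refine max_le (by simp) ((abs_min_sub_min_le_max _ _ _ _).trans ?_)
    exact max_le le_rfl (by simp)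
  have e : ∀ A B A' B' : ℝ, A * B - A' * B' = A * (B - B') + B' * (A - A') := by
    intros; ring
  rw [e]
  refine (abs_add_le _ _).trans ?_
  rw [abs_mul, abs_mul, mul_add, add_comm]
  exact add_le_add (mul_le_mul (hb b') (hl a a') (abs_nonneg _) hM)
    (mul_le_mul (hb a) (hl b b') (abs_nonneg _) hM)

theorem mul_mem_sobolevTilde (hq : IsExponentOn Ω q) (hp : IsExponentOn (Ω ×ˢ Ω) p)
    {u v : EuclideanSpace ℝ (Fin n) → ℝ} (hu : u ∈ sobolevTilde Ω s q p)
    (hv : v ∈ sobolevTilde Ω s q p) (hub : IsBoundedOn Ω u) (hvb : IsBoundedOn Ω v) :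
    (fun x => u x * v x) ∈ sobolevTilde Ω s q p := by
  obtain ⟨M₁, h₁⟩ := hub
  obtain ⟨M₂, h₂⟩ := hvb
  -- `M` is both truncation level and Lipschitz constant; `comp_mem_sobolevTilde` asks for a
  -- constant at least `1`. Truncating inside `F` means that the approximants of `u` and `v` need
  -- not obey the bound `M`.
  obtain ⟨M, hM, hM₁, hM₂⟩ : ∃ M : ℝ, 1 ≤ M ∧ M₁ ≤ M ∧ M₂ ≤ M :=
    ⟨max 1 (max M₁ M₂), le_max_left _ _, (le_max_left _ _).trans (le_max_right _ _),
      (le_max_right _ _).trans (le_max_right _ _)⟩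
  refine comp_mem_sobolevTilde hq hp
    (F := fun a b => max (-M) (min a M) * max (-M) (min b M)) hM ?_
    (abs_clamp_mul_clamp_sub_le (by linarith)) hu hv ?_
  · have : max (-M) (min 0 M) = 0 := by
      rw [min_eq_left (by linarith), max_eq_right (by linarith)]
    simp [this]
  · have hclamp : ∀ t : ℝ, |t| ≤ M → max (-M) (min t M) = t := fun t ht => by
      rw [min_eq_left (abs_le.1 ht).2, max_eq_right (abs_le.1 ht).1]
    filter_upwards [h₁, h₂] with x hx₁ hx₂
    rw [hclamp _ (hx₁.trans hM₁), hclamp _ (hx₂.trans hM₂)]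

end Sobolev

end VarSobolev

theorem mainTheorem11 (n : ℕ) (Ω : Set (EuclideanSpace ℝ (Fin n))) (hΩ : IsOpen Ω)
    (s : ℝ) (hs0 : 0 < s) (hs1 : s < 1)
    (q : EuclideanSpace ℝ (Fin n) → ℝ) (hq : VarSobolev.IsExponentOn Ω q)
    (p : EuclideanSpace ℝ (Fin n) × EuclideanSpace ℝ (Fin n) → ℝ)
    (hp : VarSobolev.IsExponentOn (Ω ×ˢ Ω) p)
    (u v : EuclideanSpace ℝ (Fin n) → ℝ)
    (hu : u ∈ VarSobolev.sobolevTildeZero Ω s q p) (hub : VarSobolev.IsBoundedOn Ω u)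
    (hv : v ∈ VarSobolev.sobolevTilde Ω s q p) (hvb : VarSobolev.IsBoundedOn Ω v)
    (hvc : VarSobolev.IsRelQuasicontinuous Ω s q p v) :
    (fun x => u x * v x) ∈ VarSobolev.sobolevTildeZero Ω s q p := by
  obtain ⟨u', hu', huc, hae, N, hN, hN0, hzero⟩ := hu
  obtain ⟨M, hM⟩ := hub
  have hub' : VarSobolev.IsBoundedOn Ω u' := ⟨M, by
    filter_upwards [hae, hM] with x h₁ h₂
    rwa [h₁]⟩
  -- The exceptional set `N` of `u'` serves again: off `Ω` the factor `u'` annihilates the product,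
  -- whatever the values of `v` there.
  refine ⟨fun x => u' x * v x, VarSobolev.mul_mem_sobolevTilde hq hp hu' hv hub' hvb,
    huc.mul hq hp hvc, hae.mono fun x hx => by simp only [hx], N, hN, hN0, fun x hx => ?_⟩
  simp only [hzero x hx, zero_mul]
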